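/- All graphs are finite, simple and undirected. For a set $L$ of integers $\ge 3$, an $L$-cycle graph is a graph in which the length (number of edges) of every cycle belongs to $L$, and $c(L,n)$ denotes the maximum number of cycles (counted as subgraphs) in an $L$-cycle graph on $n$ vertices. Let $n\ge 1$. (a) If $L$ is a (finite or infinite) set of odd integers with smallest element $2k+1>1$, then \[c(L,n)=\left\lfloor \frac{n-1}{2k}\right\rfloor .\] In particular, $c(\{2k+1\},n)=\left\lfloor \frac{n-1}{2k}\right\rfloor$ for every $k\ge 1$. (b) If $L$ consists of a single even integer $2k\ge 4$, then \[c(\{2k\},n)=\binom{\left\lfloor \frac{n-2}{k-1}\right\rfloor}{2},\] where for $n=1$ the floor is read as $0$ (so that $c(\{2k\},1)=0$). -/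

import Mathlib

/-- `G` is an `L`-cycle graph: the length of every cycle of `G` belongs to `L`. -/
def IsLCycleGraph {V : Type*} (L : Set ℕ) (G : SimpleGraph V) : Prop :=
  ∀ (v : V) (p : G.Walk v v), p.IsCycle → p.length ∈ L

/-- The cycles of `G`, as subgraphs: closed walks which are cycles and differ only in the starting
vertex or in the direction of traversal trace out the same cycle. -/
def cyclesOf {V : Type*} (G : SimpleGraph V) : Set G.Subgraph :=
  {H | ∃ (v : V) (p : G.Walk v v), p.IsCycle ∧ p.toSubgraph = H}

/-- The number of cycles of `G` (used for finite graphs). -/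
noncomputable def numCycles {V : Type*} (G : SimpleGraph V) : ℕ := (cyclesOf G).ncard

/-- `c(L, n)`: the maximum number of cycles in an `L`-cycle graph with `n` vertices. -/
noncomputable def maxCycles (L : Set ℕ) (n : ℕ) : ℕ :=
  sSup {m | ∃ G : SimpleGraph (Fin n), IsLCycleGraph L G ∧ numCycles G = m}

/-- The supremum that defines `maxCycles L n` is an attained maximum. -/
theorem isGreatest_maxCycles (L : Set ℕ) (n : ℕ) :
    IsGreatest {m | ∃ G : SimpleGraph (Fin n), IsLCycleGraph L G ∧ numCycles G = m}
      (maxCycles L n) := by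
  have hfin : {m | ∃ G : SimpleGraph (Fin n), IsLCycleGraph L G ∧ numCycles G = m}.Finite :=
    (Set.finite_range (fun G : SimpleGraph (Fin n) => numCycles G)).subset
      (by rintro m ⟨G, -, rfl⟩; exact ⟨G, rfl⟩)
  have hne : {m | ∃ G : SimpleGraph (Fin n), IsLCycleGraph L G ∧ numCycles G = m}.Nonempty := by
    refine ⟨_, ⊥, ?_, rfl⟩
    intro v p hp
    cases p with
    | nil => exact absurd rfl hp.ne_nil
    | cons h q => exact absurd h (by simp)
  exact ⟨Nat.sSup_mem hne hfin.bddAbove, fun m hm => le_csSup hfin.bddAbove hm⟩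

/-! The upper bounds come from deleting, for suitable `u ≠ v`, all edges on paths from `u` to `v`,
when these paths are pairwise internally disjoint (`PathsDisjoint`). A cycle through a deleted edge
is then the union of two of the `m` paths (`exists_toSubgraph_eq_sup`), so at most `m.choose 2`
cycles are lost. The vertices of the paths fall into distinct components
(`injOn_connectedComponentMk`), so the number of components, which never exceeds `n`, grows by at
least the number of these vertices minus one.

Such a pair exists as long as there is a cycle. Either the ends of some edge of the cycle are joined
only by that edge and the rest of the cycle (`m = 2`), or there is a theta graph
(`exists_isTheta_or`). Parity excludes a theta if all cycles are odd: every deletion costs at most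
one cycle and yields at least `2k` new components. If all cycles have length `2k`, the three paths
of a theta have length `k`, and length comparisons show that all paths between its ends are
internally disjoint (`IsTheta.internallyDisjoint`). The deletion then meets `2 + m(k-1)` vertices,
and the losses add up by superadditivity of `m.choose 2`.

Equality holds for cycles of length `2k+1` glued at one vertex, and for paths of length `k` with
common ends, in both cases with isolated vertices added. -/

namespace SimpleGraph.Walk

/-! ### Internally disjoint paths and cycles -/

variable {V : Type*} {G : SimpleGraph V}

/-- Two walks with the same ends are internally disjoint if they share no vertex but the ends. -/
def InternallyDisjoint {u v : V} (p q : G.Walk u v) : Prop :=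
  ∀ w, w ∈ p.support → w ∈ q.support → w = u ∨ w = v

theorem InternallyDisjoint.symm {u v : V} {p q : G.Walk u v} (h : p.InternallyDisjoint q) :
    q.InternallyDisjoint p := fun w hq hp => h w hp hq

theorem exists_append_first_mem {u v : V} (p : G.Walk u v) (S : Set V) (hv : v ∈ S) :
    ∃ (y : V) (q : G.Walk u y) (r : G.Walk y v), y ∈ S ∧ p = q.append r ∧
      ∀ w ∈ q.support, w ∈ S → w = y := by
  induction p with
  | nil => exact ⟨_, nil, nil, hv, rfl, by simp⟩
  | @cons a b c h p ih =>
    by_cases ha : a ∈ S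
    · exact ⟨a, nil, cons h p, ha, rfl, by simp⟩
    · obtain ⟨y, q, r, hy, rfl, hq⟩ := ih hv
      refine ⟨y, cons h q, r, hy, rfl, ?_⟩
      intro w hw hwS
      rw [support_cons, List.mem_cons] at hw
      rcases hw with rfl | hw
      · exact absurd hwS ha
      · exact hq w hw hwS

theorem exists_append_last_mem {u v : V} (p : G.Walk u v) (S : Set V) (hu : u ∈ S) :
    ∃ (y : V) (q : G.Walk u y) (r : G.Walk y v), y ∈ S ∧ p = q.append r ∧
      ∀ w ∈ r.support, w ∈ S → w = y := by
  obtain ⟨y, q, r, hy, h, hq⟩ := p.reverse.exists_append_first_mem S hu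
  refine ⟨y, r.reverse, q.reverse, hy, ?_, by simpa using hq⟩
  rw [← reverse_append, ← h, reverse_reverse]

theorem IsPath.eq_nil_of_closed {u : V} {p : G.Walk u u} (hp : p.IsPath) : p = Walk.nil :=
  (isPath_iff_nil.1 hp).eq_nil

theorem eq_of_append_left_eq {u v w : V} (p : G.Walk u v) {q r : G.Walk v w}
    (h : p.append q = p.append r) : q = r := by
  induction p with
  | nil => exact h
  | cons _ p ih =>
    rw [cons_append, cons_append] at h
    injection h with _ _ _ h
    exact ih h

theorem eq_of_append_right_eq {u v w : V} (p : G.Walk v w) {q r : G.Walk u v}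
    (h : q.append p = r.append p) : q = r := by
  have := congrArg reverse h
  rw [reverse_append, reverse_append] at this
  exact reverse_injective (eq_of_append_left_eq _ this)

theorem IsPath.append_of_forall {u v w : V} {p : G.Walk u v} {q : G.Walk v w} (hp : p.IsPath)
    (hq : q.IsPath) (h : ∀ x ∈ p.support, x ∈ q.support → x = v) : (p.append q).IsPath := by
  rw [isPath_def, support_append, List.nodup_append']
  refine ⟨hp.support_nodup, hq.support_nodup.tail, ?_⟩
  intro x hx hx'
  have := h x hx (List.mem_of_mem_tail hx')
  subst this
  have := hq.support_nodup
  rw [← cons_tail_support, List.nodup_cons] at this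
  exact this.1 hx'

theorem IsPath.eq_of_mem_append {u v w x : V} {p : G.Walk u v} {q : G.Walk v w}
    (h : (p.append q).IsPath) (hp : x ∈ p.support) (hq : x ∈ q.support) : x = v := by
  by_contra hne
  exact h.ne_of_mem_support_of_append hne hp hq rfl

theorem IsPath.isCycle_append_reverse {u v : V} {p q : G.Walk u v} (hp : p.IsPath)
    (hq : q.IsPath) (hne : p ≠ q) (h : p.InternallyDisjoint q) :
    (p.append q.reverse).IsCycle := by
  refine hp.isCycle_append hq.reverse (fun w h1 h2 ↦ ?_) ?_
  · have h3 := h w (List.mem_of_mem_tail h1) (by simpa using List.mem_of_mem_tail h2)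
    have h4 := hp.support_nodup
    have h5 := hq.reverse.support_nodup
    rw [← cons_tail_support, List.nodup_cons] at h4 h5
    rcases h3 with rfl | rfl
    · exact h4.1 h1
    · exact h5.1 h2
  -- Distinct paths with common ends cannot both have length at most one.
  · grind [length_reverse, eq_of_length_le_one]

/-- The ear `n` starts where `q` first departs from `p` and stops at its first return to `p`; the
common initial part is `a`. Nothing is claimed about the remainder `b'` of `q`. -/
theorem IsPath.exists_ear {u v : V} {p q : G.Walk u v} (hp : p.IsPath) (hq : q.IsPath)
    (hne : p ≠ q) :
    ∃ (x y : V) (a : G.Walk u x) (m n : G.Walk x y) (b b' : G.Walk y v),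
      p = a.append (m.append b) ∧ q = a.append (n.append b') ∧ m ≠ n ∧
      ∀ w ∈ n.support, w ∈ p.support → w = x ∨ w = y := by
  induction p with
  | nil => exact absurd (hq.eq_nil_of_closed).symm hne
  | @cons u s v h p ih =>
    cases q with
    | nil => exact absurd (hp.eq_nil_of_closed) (by simp)
    | @cons _ t _ h' q =>
      have hp' := (cons_isPath_iff h p).1 hp
      have hq' := (cons_isPath_iff h' q).1 hq
      by_cases hst : s = t
      · subst hst
        obtain ⟨x, y, a, m, n, b, b', rfl, rfl, hmn, hn⟩ :=
          ih hp'.1 hq'.1 (fun h => hne (by rw [h]))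
        refine ⟨x, y, cons h a, m, n, b, b', rfl, rfl, hmn, fun w hw hwp => ?_⟩
        rw [support_cons, List.mem_cons] at hwp
        rcases hwp with rfl | hwp
        · exact absurd (by simp [mem_support_append_iff, hw]) hq'.2
        · exact hn w hw hwp
      · obtain ⟨y, n, r, hy, rfl, hn⟩ :=
          q.exists_append_first_mem {w | w ∈ (cons h p).support} (end_mem_support _)
        obtain ⟨m, b, hmb⟩ := (Walk.mem_support_iff_exists_append).1 hy
        refine ⟨u, y, Walk.nil, m, cons h' n, b, r, by simpa using hmb, rfl, ?_, ?_⟩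
        · rintro rfl
          rw [cons_append] at hmb
          injection hmb with _ h1
          exact hst h1
        · intro w hw hwp
          rw [support_cons, List.mem_cons] at hw
          rcases hw with rfl | hw
          · exact Or.inl rfl
          · exact Or.inr (hn w hw hwp)

theorem IsCycle.internallyDisjoint_of_append {x y : V} {p : G.Walk x y} {q : G.Walk y x}
    (h : (p.append q).IsCycle) : p.InternallyDisjoint q.reverse := by
  intro w hp hq
  rw [support_reverse, List.mem_reverse] at hq
  have := h.support_nodup
  rw [tail_support_append, List.nodup_append'] at this
  rw [mem_support_iff] at hp hq
  rcases hp with hp | hp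
  · exact Or.inl hp
  rcases hq with hq | hq
  · exact Or.inr hq
  exact absurd hq (this.2.2 hp)

theorem IsCycle.exists_isPath_append {x z y : V} {c : G.Walk z z} (hc : c.IsCycle)
    (hx : x ∈ c.support) (hy : y ∈ c.support) (hxy : x ≠ y) :
    ∃ d₁ d₂ : G.Walk x y, d₁.IsPath ∧ d₂.IsPath ∧ d₁ ≠ d₂ ∧ d₁.InternallyDisjoint d₂ ∧
      c.toSubgraph = d₁.toSubgraph ⊔ d₂.toSubgraph ∧ c.length = d₁.length + d₂.length := by
  classical
  have hc' := (isCycle_rotate hx).2 hc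
  have hy' := (mem_support_rotate_iff c x hx).2 hy
  obtain ⟨d₁, d₂, hd⟩ := (Walk.mem_support_iff_exists_append).1 hy'
  have hlen := length_rotate c x hx
  have hsub := toSubgraph_rotate c hx
  rw [hd] at hc' hlen hsub
  have h1 : ¬ d₁.Nil := fun h => hxy h.eq
  have h2 : ¬ d₂.Nil := fun h => hxy h.eq.symm
  have h12 : d₁ ≠ d₂.reverse := by
    intro h
    have h3 := hc'.isTrail
    rw [isTrail_append] at h3
    have h4 : d₁.edges = d₂.edges.reverse := by rw [h, edges_reverse]
    have h5 : d₁.edges ≠ [] := by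
      intro h6
      have := congrArg List.length h6
      rw [length_edges] at this
      exact h1 (length_eq_zero_iff.1 this)
    obtain ⟨e, he⟩ := List.exists_mem_of_ne_nil _ h5
    exact h3.2.2 he (by rw [h4] at he; simpa using he)
  refine ⟨d₁, d₂.reverse, hc'.isPath_of_append_left h2,
    (hc'.isPath_of_append_right h1).reverse, h12, hc'.internallyDisjoint_of_append, ?_, ?_⟩
  · rw [← hsub, toSubgraph_append, toSubgraph_reverse]
  · rw [← hlen, length_append, length_reverse]

theorem IsPath.start_eq_of_append {u v : V} {p : G.Walk u v} {q : G.Walk v u}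
    (h : (p.append q).IsPath) : u = v :=
  h.eq_of_mem_append p.start_mem_support q.end_mem_support

/-- If the `u`-`v` paths are pairwise internally disjoint, then a cycle that shares an edge with
one of them is the union of two of them. -/
theorem IsCycle.exists_toSubgraph_eq_sup {u v : V}
    (hdisj : ∀ p q : G.Walk u v, p.IsPath → q.IsPath → p ≠ q → p.InternallyDisjoint q)
    {z : V} {c : G.Walk z z} (hc : c.IsCycle) {p : G.Walk u v} (hp : p.IsPath) {e : Sym2 V}
    (hep : e ∈ p.edges) (hec : e ∈ c.edges) :
    ∃ p₁ p₂ : G.Walk u v, p₁.IsPath ∧ p₂.IsPath ∧ p₁ ≠ p₂ ∧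
      c.toSubgraph = p₁.toSubgraph ⊔ p₂.toSubgraph := by
  induction e using Sym2.ind with | _ s t
  have hst : s ≠ t := (p.adj_of_mem_edges hep).ne
  have hsp := p.fst_mem_support_of_mem_edges hep
  have htp := p.snd_mem_support_of_mem_edges hep
  have hsc := c.fst_mem_support_of_mem_edges hec
  have htc := c.snd_mem_support_of_mem_edges hec
  obtain ⟨a', r', rfl⟩ := (Walk.mem_support_iff_exists_append).1 hsp
  -- `x` and `y` are the first and last vertices of `p` on the cycle, so both arcs of the cycle
  -- between them extend to `u`-`v` paths by the same end pieces.
  have key : ∃ (x y : V) (a : G.Walk u x) (b : G.Walk y v), x ∈ c.support ∧ y ∈ c.support ∧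
      x ≠ y ∧ a.IsPath ∧ b.IsPath ∧ (∀ w ∈ a.support, w ∈ c.support → w = x) ∧
      (∀ w ∈ b.support, w ∈ c.support → w = y) ∧ (∀ w ∈ a.support, w ∈ b.support → w = x) := by
    obtain ⟨x, a, r, hx, rfl, ha⟩ := a'.exists_append_first_mem {w | w ∈ c.support} hsc
    obtain ⟨y, m, b, hy, rfl, hb⟩ := r'.exists_append_last_mem {w | w ∈ c.support} hsc
    rw [← append_assoc] at hp
    have hp2 := hp.of_append_right
    refine ⟨x, y, a, b, hx, hy, ?_, hp.of_append_left, hp2.of_append_right.of_append_right, ha,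
      hb, ?_⟩
    -- If `x = y`, the piece of `p` between them is trivial and equals `s`; then `t`, which lies on
    -- `p` and on the cycle, is left without a place.
    · rintro rfl
      have hr : (r.append m).IsPath := by
        rw [append_assoc] at hp2
        exact hp2.of_append_left
      have hxs := hr.start_eq_of_append
      subst hxs
      have hrn := hr.of_append_left.eq_nil_of_closed
      have hmn := hr.of_append_right.eq_nil_of_closed
      subst hrn hmn
      simp only [append_nil, nil_append, mem_support_append_iff] at htp
      rcases htp with h | h
      · exact hst (ha t h htc).symm
      · exact hst (hb t h htc).symm
    · intro w hwa hwb
      exact hp.eq_of_mem_append hwa (by simp [mem_support_append_iff, hwb])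
  obtain ⟨x, y, a, b, hx, hy, hxy, hap, hbp, ha, hb, hab⟩ := key
  obtain ⟨d₁, d₂, h1, h2, h12, -, hsub, -⟩ := hc.exists_isPath_append hx hy hxy
  have hd : ∀ w, w ∈ d₁.support ∨ w ∈ d₂.support → w ∈ c.support := by
    intro w hw
    rw [← mem_verts_toSubgraph, hsub, Subgraph.verts_sup]
    simpa [mem_verts_toSubgraph] using hw
  have hpath : ∀ d : G.Walk x y, d.IsPath → (∀ w ∈ d.support, w ∈ c.support) →
      (a.append (d.append b)).IsPath := by
    intro d hdp hdc
    refine hap.append_of_forall (hdp.append_of_forall hbp fun w hw hwb => hb w hwb (hdc w hw)) ?_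
    intro w hwa hw
    rcases (mem_support_append_iff _ _).1 hw with hw | hw
    · exact ha w hwa (hdc w hw)
    · exact hab w hwa hw
  have hP1 := hpath d₁ h1 fun w hw => hd w (Or.inl hw)
  have hP2 := hpath d₂ h2 fun w hw => hd w (Or.inr hw)
  have hne : a.append (d₁.append b) ≠ a.append (d₂.append b) := by
    intro h
    exact h12 (eq_of_append_right_eq _ (eq_of_append_left_eq _ h))
  -- Both paths contain `x` and `y`, so disjointness forces these to be `u` and `v`.
  have hD := hdisj _ _ hP1 hP2 hne
  have hxu : x = u := by
    rcases hD x (by simp [mem_support_append_iff]) (by simp [mem_support_append_iff]) with h | h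
    · exact h
    · subst h
      have := hP1.of_append_right.start_eq_of_append
      exact absurd this hxy
  subst hxu
  have hyv : y = v := by
    rcases hD y (by simp [mem_support_append_iff]) (by simp [mem_support_append_iff]) with h | h
    · exact absurd h.symm hxy
    · exact h
  subst hyv
  exact ⟨d₁, d₂, h1, h2, h12, hsub⟩

end SimpleGraph.Walk

/-! ### Theta graphs -/

namespace SimpleGraph.Walk

variable {V : Type*} {G : SimpleGraph V}

/-- Three distinct, pairwise internally disjoint paths with the same ends. -/
structure IsTheta {u v : V} (p q r : G.Walk u v) : Prop where
  isPath₁ : p.IsPath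
  isPath₂ : q.IsPath
  isPath₃ : r.IsPath
  ne₁₂ : p ≠ q
  ne₁₃ : p ≠ r
  ne₂₃ : q ≠ r
  disj₁₂ : p.InternallyDisjoint q
  disj₁₃ : p.InternallyDisjoint r
  disj₂₃ : q.InternallyDisjoint r

theorem IsTheta.swap {u v : V} {p q r : G.Walk u v} (h : IsTheta p q r) : IsTheta q p r :=
  ⟨h.isPath₂, h.isPath₁, h.isPath₃, h.ne₁₂.symm, h.ne₂₃, h.ne₁₃, h.disj₁₂.symm, h.disj₂₃,
    h.disj₁₃⟩

theorem IsTheta.rotate {u v : V} {p q r : G.Walk u v} (h : IsTheta p q r) : IsTheta q r p :=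
  ⟨h.isPath₂, h.isPath₃, h.isPath₁, h.ne₂₃, h.ne₁₂.symm, h.ne₁₃.symm, h.disj₂₃, h.disj₁₂.symm,
    h.disj₁₃.symm⟩

theorem length_add_length_mem {L : Set ℕ} (hG : IsLCycleGraph L G) {u v : V} {p q : G.Walk u v}
    (hp : p.IsPath) (hq : q.IsPath) (hne : p ≠ q) (h : p.InternallyDisjoint q) :
    p.length + q.length ∈ L := by
  have := hG _ _ (hp.isCycle_append_reverse hq hne h)
  rwa [length_append, length_reverse] at this

theorem length_add_length_eq {k : ℕ} (hG : IsLCycleGraph {2 * k} G) {u v : V} {p q : G.Walk u v}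
    (hp : p.IsPath) (hq : q.IsPath) (hne : p ≠ q) (h : p.InternallyDisjoint q) :
    p.length + q.length = 2 * k :=
  length_add_length_mem hG hp hq hne h

theorem IsTheta.length_eq {k : ℕ} (hG : IsLCycleGraph {2 * k} G) {u v : V} {p q r : G.Walk u v}
    (h : IsTheta p q r) : p.length = k := by
  have h1 := length_add_length_eq hG h.isPath₁ h.isPath₂ h.ne₁₂ h.disj₁₂
  have h2 := length_add_length_eq hG h.isPath₁ h.isPath₃ h.ne₁₃ h.disj₁₃
  have h3 := length_add_length_eq hG h.isPath₂ h.isPath₃ h.ne₂₃ h.disj₂₃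
  omega

/-- The three cycle lengths add up to twice the total length of the paths, but three odd numbers
have an odd sum. -/
theorem not_isTheta_of_forall_odd {L : Set ℕ} (hL : ∀ m ∈ L, Odd m) (hG : IsLCycleGraph L G)
    {u v : V} {p q r : G.Walk u v} (h : IsTheta p q r) : False := by
  have h1 := hL _ (length_add_length_mem hG h.isPath₁ h.isPath₂ h.ne₁₂ h.disj₁₂)
  have h2 := hL _ (length_add_length_mem hG h.isPath₁ h.isPath₃ h.ne₁₃ h.disj₁₃)
  have h3 := hL _ (length_add_length_mem hG h.isPath₂ h.isPath₃ h.ne₂₃ h.disj₂₃)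
  rw [Nat.odd_iff] at h1 h2 h3
  omega

/-- The witness is a segment of `n`, possibly reversed. The last clause keeps the ends of `n` out of
it unless they are `z` or `w`. -/
theorem IsPath.exists_isPath_between {x y z w : V} {n : G.Walk x y} (hn : n.IsPath)
    (hz : z ∈ n.support) (hw : w ∈ n.support) :
    ∃ r : G.Walk z w, r.IsPath ∧ (∀ t ∈ r.support, t ∈ n.support) ∧
      ∀ t ∈ r.support, t = x ∨ t = y → t = z ∨ t = w := by
  obtain ⟨n₁, n₂, rfl⟩ := (Walk.mem_support_iff_exists_append).1 hz
  rcases (mem_support_append_iff _ _).1 hw with h | h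
  · obtain ⟨n₀, r, rfl⟩ := (Walk.mem_support_iff_exists_append).1 h
    refine ⟨r.reverse, hn.of_append_left.of_append_right.reverse, ?_, ?_⟩
    · intro t ht
      rw [support_reverse, List.mem_reverse] at ht
      simp [mem_support_append_iff, ht]
    · intro t ht hxy
      rw [support_reverse, List.mem_reverse] at ht
      rcases hxy with rfl | rfl
      · exact Or.inr (hn.of_append_left.eq_of_mem_append (start_mem_support _) ht)
      · exact Or.inl (hn.eq_of_mem_append (by simp [mem_support_append_iff, ht])
          (end_mem_support _))
  · obtain ⟨r, n₀, rfl⟩ := (Walk.mem_support_iff_exists_append).1 h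
    refine ⟨r, hn.of_append_right.of_append_left, ?_, ?_⟩
    · intro t ht
      simp [mem_support_append_iff, ht]
    · intro t ht hxy
      rcases hxy with rfl | rfl
      · exact Or.inl (hn.eq_of_mem_append (start_mem_support _)
          (by simp [mem_support_append_iff, ht]))
      · exact Or.inr (hn.of_append_right.eq_of_mem_append ht (end_mem_support _))

/-- If all cycles have length `2k`, then no path joins the interiors of two paths of a theta
graph and avoids the third one. -/
theorem IsTheta.not_exists_cross {k : ℕ} (hG : IsLCycleGraph {2 * k} G) {u v : V}
    {p q r : G.Walk u v} (h : IsTheta p q r) {z w : V} {s : G.Walk z w} (hs : s.IsPath)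
    (hz : z ∈ q.support) (hw : w ∈ r.support) (hsp : ∀ t ∈ s.support, t ∉ p.support) : False := by
  -- Trim `s` so that it meets `q` and `r` only at its ends.
  obtain ⟨w, s₁, s₀, hw, rfl, hs1⟩ := s.exists_append_first_mem {t | t ∈ r.support} hw
  obtain ⟨z, s₀', s, hz, rfl, hs2⟩ := s₁.exists_append_last_mem {t | t ∈ q.support} hz
  replace hs := hs.of_append_left.of_append_right
  replace hsp : ∀ t ∈ s.support, t ∉ p.support :=
    fun t ht => hsp t (by simp [mem_support_append_iff, ht])
  replace hs1 : ∀ t ∈ s.support, t ∈ r.support → t = w :=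
    fun t ht => hs1 t (by simp [mem_support_append_iff, ht])
  replace hs2 : ∀ t ∈ s.support, t ∈ q.support → t = z := hs2
  have hzp := hsp z s.start_mem_support
  have hwp := hsp w s.end_mem_support
  have hzu : z ≠ u := fun h => hzp (h ▸ p.start_mem_support)
  have hzv : z ≠ v := fun h => hzp (h ▸ p.end_mem_support)
  have hwv : w ≠ v := fun h => hwp (h ▸ p.end_mem_support)
  have hq := h.length_eq hG
  have hr := h.rotate.rotate.length_eq hG
  have h23 := h.disj₂₃
  have h12 := h.disj₁₂
  have h13 := h.disj₁₃
  have hqp := h.isPath₂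
  have hrp := h.isPath₃
  have hpp := h.isPath₁
  clear h
  obtain ⟨a, a', rfl⟩ := (Walk.mem_support_iff_exists_append).1 hz
  obtain ⟨b, b', rfl⟩ := (Walk.mem_support_iff_exists_append).1 hw
  have hva : v ∉ a.support := fun hv => hzv (hqp.eq_of_mem_append hv (end_mem_support _)).symm
  have has : (a.append s).IsPath := by
    refine hqp.of_append_left.append_of_forall hs fun t ht hts => ?_
    exact hs2 t hts (by simp [mem_support_append_iff, ht])
  -- With `q` and `r` split at `z` and `w`, the two cycles give `|a| + |s| + |b| = 2k` and `|a| +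
  -- |s| + |b'| + k = 2k`. As `|b| + |b'| = k`, this forces `|b'| = 0`, that is `w = v`.
  have e1 := length_add_length_eq hG has hrp.of_append_left ?_ ?_
  have e2 := length_add_length_eq hG (p := (a.append s).append b') (q := p) ?_ hpp ?_ ?_
  · simp only [length_append] at e1 e2 hr
    exact hwv (eq_of_length_eq_zero (p := b') (by omega))
  · refine has.append_of_forall hrp.of_append_right fun t ht htb => ?_
    rcases (mem_support_append_iff _ _).1 ht with ht | ht
    · rcases h23 t (by simp [mem_support_append_iff, ht])
        (by simp [mem_support_append_iff, htb]) with rfl | rfl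
      · exact hrp.eq_of_mem_append (start_mem_support _) htb
      · exact absurd ht hva
    · exact hs1 t ht (by simp [mem_support_append_iff, htb])
  · rintro rfl
    exact hzp (by simp [mem_support_append_iff])
  · intro t ht htp
    simp only [mem_support_append_iff] at ht
    rcases ht with (ht | ht) | ht
    · exact h12 t htp (by simp [mem_support_append_iff, ht])
    · exact absurd htp (hsp t ht)
    · exact h13 t htp (by simp [mem_support_append_iff, ht])
  · rintro rfl
    rcases h23 z hz (by simp [mem_support_append_iff]) with h | h
    · exact hzu h
    · exact hzv h
  · intro t ht htb
    rcases (mem_support_append_iff _ _).1 ht with ht | ht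
    · rcases h23 t (by simp [mem_support_append_iff, ht])
        (by simp [mem_support_append_iff, htb]) with rfl | rfl
      · exact Or.inl rfl
      · exact absurd ht hva
    · exact Or.inr (hs1 t ht (by simp [mem_support_append_iff, htb]))

/-- An ear of `s` on `p` that does not join `u` to `v` must meet both `q` and `r` off `p`; its
segment between two such vertices is a forbidden cross path. -/
theorem IsTheta.internallyDisjoint {k : ℕ} (hG : IsLCycleGraph {2 * k} G) {u v : V}
    {p q r s : G.Walk u v} (h : IsTheta p q r) (hs : s.IsPath) (hne : p ≠ s) :
    p.InternallyDisjoint s := by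
  obtain ⟨x, y, a, m, n, b, b', hpe, hse, hmn, hn⟩ := h.isPath₁.exists_ear hs hne
  have hpp := h.isPath₁
  rw [hpe] at hpp
  have hsp := hs
  rw [hse] at hsp
  have hmp : m.IsPath := hpp.of_append_right.of_append_left
  have hnp : n.IsPath := hsp.of_append_right.of_append_left
  have hxy : x ≠ y := by
    rintro rfl
    exact hmn (hmp.eq_nil_of_closed.trans hnp.eq_nil_of_closed.symm)
  have hin : ∀ t, t ∈ a.support ∨ t ∈ m.support ∨ t ∈ b.support → t ∈ p.support := by
    intro t ht
    rw [hpe]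
    simpa [mem_support_append_iff] using ht
  have hxp := hin x (by simp)
  have hyp := hin y (by simp)
  by_cases hends : x = u ∧ y = v
  · obtain ⟨rfl, rfl⟩ := hends
    have h1 := hsp.of_append_left.eq_nil_of_closed
    have h2 := hsp.of_append_right.of_append_right.eq_nil_of_closed
    subst h1 h2
    rw [nil_append, append_nil] at hse
    subst hse
    exact fun t ht ht' => hn t ht' ht
  have hlen := length_add_length_eq hG hmp hnp hmn
    fun t ht ht' => hn t ht' (hin t (by simp [ht]))
  have key : ∀ q r : G.Walk u v, IsTheta p q r → ∃ t ∈ n.support, t ∈ q.support ∧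
      t ∉ p.support := by
    intro q r h
    by_contra! hcon
    -- Were `n` to meet `q` only on `p`, the detour `a n b` would form a cycle with `q`. Then `|a| +
    -- |n| + |b| = k`, and with `|a| + |m| + |b| = k` and `|m| + |n| = 2k` both `a` and `b` are
    -- trivial.
    have e := length_add_length_eq hG (p := a.append (n.append b)) (q := q) ?_ h.isPath₂ ?_ ?_
    · have e1 := h.length_eq hG
      have e2 := h.rotate.length_eq hG
      rw [hpe] at e1
      simp only [length_append] at e e1
      exact hends ⟨(eq_of_length_eq_zero (p := a) (by omega)).symm,
        eq_of_length_eq_zero (p := b) (by omega)⟩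
    · refine hpp.of_append_left.append_of_forall
        (hnp.append_of_forall hpp.of_append_right.of_append_right ?_) ?_
      · intro t ht htb
        rcases hn t ht (hin t (by simp [htb])) with rfl | rfl
        · exact hpp.of_append_right.eq_of_mem_append (start_mem_support _) htb
        · rfl
      · intro t ht htb
        rcases (mem_support_append_iff _ _).1 htb with htn | htb
        · rcases hn t htn (hin t (by simp [ht])) with rfl | rfl
          · rfl
          · exact hpp.eq_of_mem_append ht (by simp [mem_support_append_iff])
        · exact hpp.eq_of_mem_append ht (by simp [mem_support_append_iff, htb])
    · rintro rfl
      refine hends ⟨?_, ?_⟩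
      · rcases h.disj₁₂ x hxp (by simp [mem_support_append_iff]) with h | h
        · exact h
        · subst h
          exact absurd hpp.of_append_right.start_eq_of_append hxy
      · rcases h.disj₁₂ y hyp (by simp [mem_support_append_iff]) with h | h
        · subst h
          rw [append_assoc] at hpp
          exact absurd hpp.of_append_left.start_eq_of_append.symm hxy
        · exact h
    · intro t ht htq
      simp only [mem_support_append_iff] at ht
      rcases ht with ht | ht | ht
      · exact h.disj₁₂ t (hin t (by simp [ht])) htq
      · exact h.disj₁₂ t (hcon t ht htq) htq
      · exact h.disj₁₂ t (hin t (by simp [ht])) htq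
  obtain ⟨z, hzn, hzq, hzp⟩ := key q r h
  obtain ⟨w, hwn, hwr, hwp⟩ := key r q h.swap.rotate
  obtain ⟨c, hc, hcn, hcxy⟩ := hnp.exists_isPath_between hzn hwn
  refine (h.not_exists_cross hG hc hzq hwr fun t ht htp => ?_).elim
  rcases hcxy t ht (hn t (hcn t ht) htp) with rfl | rfl
  · exact hzp htp
  · exact hwp htp

/-- Since every path is a member of some theta, what holds for the first path of a theta holds for
all `u`-`v` paths. -/
theorem IsTheta.exists_isTheta {k : ℕ} (hG : IsLCycleGraph {2 * k} G) {u v : V}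
    {p q r s : G.Walk u v} (h : IsTheta p q r) (hs : s.IsPath) :
    ∃ q' r' : G.Walk u v, IsTheta s q' r' := by
  by_cases h1 : p = s
  · exact ⟨q, r, h1 ▸ h⟩
  by_cases h2 : q = s
  · exact ⟨r, p, h2 ▸ h.rotate⟩
  exact ⟨p, q, hs, h.isPath₁, h.isPath₂, Ne.symm h1, Ne.symm h2, h.ne₁₂,
    (h.internallyDisjoint hG hs h1).symm, (h.rotate.internallyDisjoint hG hs h2).symm, h.disj₁₂⟩

/-- An edge `uv` of a cycle either has only two `u`-`v` paths, namely itself and the rest of the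
cycle, or the graph contains a theta graph. -/
theorem IsCycle.exists_isTheta_or {z : V} {c : G.Walk z z} (hc : c.IsCycle) :
    (∃ (u v : V) (p q : G.Walk u v), p.IsPath ∧ q.IsPath ∧ p ≠ q ∧ p.InternallyDisjoint q ∧
      p.length = 1 ∧ q.length + 1 = c.length ∧ ∀ s : G.Walk u v, s.IsPath → s = p ∨ s = q) ∨
    ∃ (x y : V) (p q r : G.Walk x y), IsTheta p q r := by
  cases c with
  | nil => exact absurd hc not_isCycle_nil
  | @cons _ v _ h p =>
    rw [cons_isCycle_iff] at hc
    have hedge : ∀ t, t ∈ (cons h nil : G.Walk z v).support → t = z ∨ t = v := by simp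
    have hep : (cons h nil : G.Walk z v).IsPath := by simp [h.ne]
    by_cases hall : ∀ s : G.Walk z v, s.IsPath → s = cons h nil ∨ s = p.reverse
    · refine Or.inl ⟨z, v, cons h nil, p.reverse, hep, hc.1.reverse, ?_, fun t ht _ => hedge t ht,
        by simp, by simp, hall⟩
      intro heq
      apply hc.2
      have : s(z, v) ∈ p.reverse.edges := by rw [← heq]; simp
      simpa using this
    · right
      push Not at hall
      obtain ⟨s, hs, hse, hsp⟩ := hall
      obtain ⟨x, y, a, m, n, b, b', hpe, hqe, hmn, hn⟩ := hc.1.reverse.exists_ear hs hsp.symm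
      have hpp := hc.1.reverse
      have hnot : s(z, v) ∉ p.reverse.edges := by simpa using hc.2
      rw [hpe] at hpp hn hnot
      rw [hqe] at hs
      have hr : ∀ t, t ∈ ((a.reverse.append (cons h nil)).append b.reverse).support →
          t ∈ a.support ∨ t ∈ b.support := by
        intro t ht
        simp only [mem_support_append_iff, support_reverse, List.mem_reverse] at ht
        rcases ht with (ht | ht) | ht
        · exact Or.inl ht
        · rcases hedge t ht with rfl | rfl
          · exact Or.inl (start_mem_support _)
          · exact Or.inr (end_mem_support _)
        · exact Or.inr ht
      have hab : ∀ t, t ∈ a.support → t ∈ b.support → x = y := by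
        intro t ha hb
        have h1 := hpp.eq_of_mem_append ha (by simp [mem_support_append_iff, hb])
        rw [append_assoc] at hpp
        have h2 := hpp.eq_of_mem_append (by simp [mem_support_append_iff, ha]) hb
        exact h1.symm.trans h2
      have hmp : m.IsPath := hpp.of_append_right.of_append_left
      have hnp : n.IsPath := hs.of_append_right.of_append_left
      have hxy : x ≠ y := by
        rintro rfl
        exact hmn (hmp.eq_nil_of_closed.trans hnp.eq_nil_of_closed.symm)
      -- The third path runs back along `a`, across the edge `zv`, and back along `b`.
      refine ⟨x, y, m, n, (a.reverse.append (cons h nil)).append b.reverse, hmp, hnp, ?_, hmn, ?_,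
        ?_, ?_, ?_, ?_⟩
      · have hz : z ∉ b.support := fun hz => hxy (hab z (start_mem_support _) hz)
        have hv : v ∉ a.support := fun hv => hxy (hab v hv (end_mem_support _))
        refine (hpp.of_append_left.reverse.append_of_forall hep ?_).append_of_forall
          hpp.of_append_right.of_append_right.reverse ?_
        · intro t ht hte
          rcases hedge t hte with rfl | rfl
          · rfl
          · exact absurd (by simpa using ht) hv
        · intro t ht htb
          simp only [mem_support_append_iff, support_reverse, List.mem_reverse] at ht htb
          rcases ht with ht | ht
          · exact absurd (hab t ht htb) hxy
          · rcases hedge t ht with rfl | rfl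
            · exact absurd htb hz
            · rfl
      · rintro rfl
        apply hnot
        simp
      · rintro rfl
        apply hse
        have h1 : s(z, v) ∈ s.edges := by rw [hqe]; simp
        exact (hqe ▸ hs : s.IsPath).eq_adj_toWalk_of_mem_edges h1
      · exact fun t ht ht' => hn t ht' (by simp [mem_support_append_iff, ht])
      · intro t ht htr
        rcases hr t htr with h | h
        · exact Or.inl (hpp.eq_of_mem_append h (by simp [mem_support_append_iff, ht]))
        · exact Or.inr (hpp.of_append_right.eq_of_mem_append ht h)
      · intro t ht htr
        refine hn t ht ?_
        simp only [mem_support_append_iff]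
        rcases hr t htr with h | h
        · exact Or.inl h
        · exact Or.inr (Or.inr h)

end SimpleGraph.Walk

/-! ### Deleting all paths between two vertices -/

namespace SimpleGraph

variable {V : Type*} {G : SimpleGraph V}

/-- Each component of `G` other than `c` contains one of `G'`, while `c` contains at least `S.ncard`
of them. -/
theorem card_connectedComponent_add_ncard_le [Finite V] {G' : SimpleGraph V} (h : G' ≤ G)
    (S : Set V) (c : G.ConnectedComponent) (hc : ∀ x ∈ S, G.connectedComponentMk x = c)
    (hS : Set.InjOn G'.connectedComponentMk S) :
    Nat.card G.ConnectedComponent + S.ncard ≤ Nat.card G'.ConnectedComponent + 1 := by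
  classical
  let φ : G'.ConnectedComponent → G.ConnectedComponent := ConnectedComponent.map (Hom.ofLE h)
  have hφ : ∀ x, φ (G'.connectedComponentMk x) = G.connectedComponentMk x := fun x => rfl
  have hsurj : Function.Surjective φ := by
    intro d
    induction d using ConnectedComponent.ind with | _ x
    exact ⟨G'.connectedComponentMk x, rfl⟩
  let f : {d : G.ConnectedComponent // d ≠ c} ⊕ S → G'.ConnectedComponent :=
    Sum.elim (fun d => Function.surjInv hsurj d.1) (fun s => G'.connectedComponentMk s.1)
  have hf : Function.Injective f := by
    rintro (⟨a, ha⟩ | ⟨a, ha⟩) (⟨b, hb⟩ | ⟨b, hb⟩) hab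
    · have := congrArg φ hab
      simp only [f, Sum.elim_inl, Function.surjInv_eq] at this
      subst this
      rfl
    · have := congrArg φ hab
      simp only [f, Sum.elim_inl, Sum.elim_inr, Function.surjInv_eq, hφ, hc b hb] at this
      exact absurd this ha
    · have := congrArg φ hab
      simp only [f, Sum.elim_inl, Sum.elim_inr, Function.surjInv_eq, hφ, hc a ha] at this
      exact absurd this.symm hb
    · have := hS ha hb hab
      subst this
      rfl
  have h1 := Nat.card_le_card_of_injective f hf
  rw [Nat.card_sum, Nat.card_coe_set_eq] at h1
  have h2 : Nat.card {d : G.ConnectedComponent // d ≠ c} + 1 = Nat.card G.ConnectedComponent := by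
    rw [← Finite.card_option, Nat.card_congr (Equiv.optionSubtypeNe c)]
  omega

/-- The edges of the paths from `u` to `v`. -/
def pathEdges (G : SimpleGraph V) (u v : V) : Set (Sym2 V) :=
  {e | ∃ p : G.Walk u v, p.IsPath ∧ e ∈ p.edges}

/-- The vertices of the paths from `u` to `v`. -/
def pathVerts (G : SimpleGraph V) (u v : V) : Set V :=
  {w | ∃ p : G.Walk u v, p.IsPath ∧ w ∈ p.support}

/-- All paths from `u` to `v` are internally disjoint. -/
def PathsDisjoint (G : SimpleGraph V) (u v : V) : Prop :=
  ∀ p q : G.Walk u v, p.IsPath → q.IsPath → p ≠ q → p.InternallyDisjoint q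

theorem exists_walk_of_mem_pathVerts {u v w : V} (hw : w ∈ G.pathVerts u v) :
    ∃ q : G.Walk u w, ∀ e ∈ q.edges, e ∈ G.pathEdges u v := by
  obtain ⟨p, hp, hw⟩ := hw
  obtain ⟨q, r, rfl⟩ := Walk.mem_support_iff_exists_append.1 hw
  exact ⟨q, fun e he => ⟨_, hp, by simp [Walk.edges_append, he]⟩⟩

/-- A surviving path between two such vertices, together with a path of deleted edges, contains a
cycle with edges of both kinds. But a cycle with one deleted edge is a union of `u`-`v` paths, so
all its edges are deleted. -/
theorem PathsDisjoint.injOn_connectedComponentMk {u v : V} (h : G.PathsDisjoint u v) :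
    Set.InjOn (G.deleteEdges (G.pathEdges u v)).connectedComponentMk (G.pathVerts u v) := by
  classical
  intro x hx y hy hxy
  by_contra hne
  obtain ⟨s', hs'⟩ := (ConnectedComponent.exact hxy).exists_isPath
  let s : G.Walk x y := s'.mapLe (deleteEdges_le _)
  have hs : s.IsPath := hs'.mapLe _
  have hse : ∀ e ∈ s.edges, e ∉ G.pathEdges u v := by
    intro e he
    have h1 : e ∈ s'.edges := by simpa [s] using he
    have h2 := s'.edges_subset_edgeSet h1
    rw [edgeSet_deleteEdges] at h2
    exact h2.2
  obtain ⟨a, ha⟩ := exists_walk_of_mem_pathVerts hx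
  obtain ⟨b, hb⟩ := exists_walk_of_mem_pathVerts hy
  let r : G.Walk x y := (a.reverse.append b).bypass
  have hr : r.IsPath := Walk.bypass_isPath _
  have hre : ∀ e ∈ r.edges, e ∈ G.pathEdges u v := by
    intro e he
    have := Walk.edges_bypass_subset_edges _ he
    simp only [Walk.edges_append, Walk.edges_reverse, List.mem_append, List.mem_reverse] at this
    exact this.elim (ha e) (hb e)
  have edge : ∀ {x y : V} (p : G.Walk x y), x ≠ y → ∃ e, e ∈ p.edges := by
    intro x y p hxy
    cases p with
    | nil => exact absurd rfl hxy
    | cons h p => exact ⟨_, by rw [Walk.edges_cons]; exact List.mem_cons_self⟩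
  have hrs : r ≠ s := by
    intro hrs
    obtain ⟨e, he⟩ := edge r hne
    exact hse e (hrs ▸ he) (hre e he)
  obtain ⟨x', y', r', t, hr', ht, hcyc⟩ := hr.exists_isCycle_of_ne hs hrs
  have hrp : r'.IsPath := Walk.isPath_of_isSubwalk hr' hr
  have htp : t.IsPath := Walk.isPath_of_isSubwalk ht hs
  have hxy' : x' ≠ y' := by
    rintro rfl
    rw [hrp.eq_nil_of_closed, htp.eq_nil_of_closed] at hcyc
    exact Walk.not_isCycle_nil hcyc
  obtain ⟨e, he⟩ := edge r' hxy'
  obtain ⟨f, hf⟩ := edge t hxy'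
  obtain ⟨p, hp, hep⟩ := hre e (hr'.edges_subset he)
  obtain ⟨p₁, p₂, h1, h2, -, hsub⟩ := hcyc.exists_toSubgraph_eq_sup h hp hep
    (by simp [Walk.edges_append, he])
  have hf' : f ∈ ((r'.append t.reverse).toSubgraph).edgeSet := by
    rw [Walk.mem_edges_toSubgraph]
    simp [Walk.edges_append, hf]
  rw [hsub, Subgraph.edgeSet_sup] at hf'
  refine hse f (ht.edges_subset hf) ?_
  rcases hf' with hf' | hf'
  · exact ⟨p₁, h1, (Walk.mem_edges_toSubgraph _).1 hf'⟩
  · exact ⟨p₂, h2, (Walk.mem_edges_toSubgraph _).1 hf'⟩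

theorem PathsDisjoint.card_connectedComponent_add_le [Finite V] {u v : V}
    (h : G.PathsDisjoint u v) :
    Nat.card G.ConnectedComponent + (G.pathVerts u v).ncard ≤
      Nat.card (G.deleteEdges (G.pathEdges u v)).ConnectedComponent + 1 := by
  refine card_connectedComponent_add_ncard_le (deleteEdges_le _) _ (G.connectedComponentMk u) ?_
    h.injOn_connectedComponentMk
  intro x hx
  obtain ⟨q, -⟩ := exists_walk_of_mem_pathVerts hx
  exact ConnectedComponent.sound q.reverse.reachable

theorem PathsDisjoint.numCycles_le [Finite V] {u v : V} (h : G.PathsDisjoint u v) :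
    numCycles G ≤ numCycles (G.deleteEdges (G.pathEdges u v)) +
      (Nat.card (G.Path u v)).choose 2 := by
  classical
  have := Fintype.ofFinite V
  let T : Finset G.Subgraph := (Finset.powersetCard 2 (Finset.univ : Finset (G.Path u v))).image
    fun s => s.sup fun p => p.1.toSubgraph
  have hsub : cyclesOf G ⊆ (Subgraph.map (Hom.ofLE (deleteEdges_le (G.pathEdges u v)))) ''
      cyclesOf (G.deleteEdges (G.pathEdges u v)) ∪ (T : Set G.Subgraph) := by
    rintro _ ⟨z, c, hc, rfl⟩
    by_cases hce : ∃ e ∈ c.edges, e ∈ G.pathEdges u v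
    · right
      obtain ⟨e, hec, p, hp, hep⟩ := hce
      obtain ⟨p₁, p₂, h1, h2, hne, hs⟩ := hc.exists_toSubgraph_eq_sup h hp hep hec
      refine Finset.mem_coe.2 (Finset.mem_image.2 ⟨{⟨p₁, h1⟩, ⟨p₂, h2⟩}, ?_, ?_⟩)
      · rw [Finset.mem_powersetCard]
        exact ⟨Finset.subset_univ _, Finset.card_pair fun h => hne (congrArg Subtype.val h)⟩
      · rw [hs, Finset.sup_insert, Finset.sup_singleton]
    · left
      push Not at hce
      have hmem : ∀ e ∈ c.edges, e ∈ (G.deleteEdges (G.pathEdges u v)).edgeSet := by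
        intro e he
        rw [edgeSet_deleteEdges]
        exact ⟨c.edges_subset_edgeSet he, hce e he⟩
      refine ⟨(c.transfer _ hmem).toSubgraph, ⟨z, _, hc.transfer hmem, rfl⟩, ?_⟩
      rw [← Walk.toSubgraph_map, ← Walk.transfer_eq_map_ofLE (hp := ?_), Walk.transfer_transfer,
        Walk.transfer_self]
      intro e he
      rw [Walk.edges_transfer] at he
      exact c.edges_subset_edgeSet he
  calc numCycles G ≤ _ := Set.ncard_le_ncard hsub (Set.toFinite _)
    _ ≤ _ := Set.ncard_union_le _ _
    _ ≤ _ := by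
      refine add_le_add (Set.ncard_image_le (Set.toFinite _)) ?_
      rw [Set.ncard_coe_finset]
      refine Finset.card_image_le.trans ?_
      rw [Finset.card_powersetCard, Finset.card_univ, Nat.card_eq_fintype_card]

/-- The interiors are disjoint, with `k - 1` vertices each; reachability puts `u` and `v` themselves
on a path. -/
theorem ncard_pathVerts_ge [Finite V] {u v : V} (h : G.PathsDisjoint u v) (huv : u ≠ v) {k : ℕ}
    (hk : ∀ p : G.Walk u v, p.IsPath → p.length = k) (hne : G.Reachable u v) :
    2 + Nat.card (G.Path u v) * (k - 1) ≤ (G.pathVerts u v).ncard := by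
  classical
  have := Fintype.ofFinite V
  let I : G.Path u v → Finset V := fun p => (p.1.support.toFinset.erase u).erase v
  have hI : ∀ p : G.Path u v, (I p).card = k - 1 := by
    intro p
    have h1 : p.1.support.toFinset.card = k + 1 := by
      rw [List.toFinset_card_of_nodup p.2.support_nodup, Walk.length_support, hk _ p.2]
    rw [Finset.card_erase_of_mem (by simp [huv.symm]), Finset.card_erase_of_mem (by simp), h1]
    omega
  have hdisj : ∀ p ∈ (Finset.univ : Finset (G.Path u v)), ∀ q ∈ Finset.univ, p ≠ q →
      Disjoint (I p) (I q) := by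
    intro p _ q _ hpq
    rw [Finset.disjoint_left]
    intro w hp hq
    simp only [I, Finset.mem_erase, List.mem_toFinset] at hp hq
    rcases h p.1 q.1 p.2 q.2 (fun h => hpq (Subtype.ext h)) w hp.2.2 hq.2.2 with h | h
    · exact hp.2.1 h
    · exact hp.1 h
  have hcard := Finset.card_biUnion hdisj
  simp only [hI, Finset.sum_const, Finset.card_univ, smul_eq_mul] at hcard
  have hu : u ∉ insert v (Finset.univ.biUnion I) := by simp [I, huv]
  have hv : v ∉ Finset.univ.biUnion I := by simp [I]
  have htot : (insert u (insert v (Finset.univ.biUnion I))).card =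
      2 + Nat.card (G.Path u v) * (k - 1) := by
    rw [Finset.card_insert_of_notMem hu, Finset.card_insert_of_notMem hv, hcard,
      Nat.card_eq_fintype_card]
    omega
  rw [← htot, ← Set.ncard_coe_finset]
  refine Set.ncard_le_ncard ?_ (Set.toFinite _)
  obtain ⟨p, hp⟩ := hne.exists_isPath
  intro w hw
  simp only [Finset.coe_insert, Set.mem_insert_iff, Finset.mem_coe, Finset.mem_biUnion] at hw
  rcases hw with rfl | rfl | ⟨q, -, hq⟩
  · exact ⟨p, hp, Walk.start_mem_support _⟩
  · exact ⟨p, hp, Walk.end_mem_support _⟩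
  · simp only [I, Finset.mem_erase, List.mem_toFinset] at hq
    exact ⟨q.1, q.2, hq.2.2⟩

end SimpleGraph

/-! ### Upper bounds by induction on the graph -/

namespace SimpleGraph

variable {V : Type*} {G : SimpleGraph V}

theorem isLCycleGraph_mono {L : Set ℕ} {G' : SimpleGraph V} (hG : IsLCycleGraph L G)
    (h : G' ≤ G) : IsLCycleGraph L G' := by
  intro v p hp
  have := hG v (p.mapLe h) (hp.mapLe h)
  simpa using this

theorem deleteEdges_pathEdges_lt {u v : V} (huv : u ≠ v) (h : G.Reachable u v) :
    G.deleteEdges (G.pathEdges u v) < G := by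
  refine lt_of_le_of_ne (deleteEdges_le _) fun heq => ?_
  obtain ⟨p, hp⟩ := h.exists_isPath
  cases p with
  | nil => exact huv rfl
  | @cons _ w _ h p =>
    have h' : (G.deleteEdges (G.pathEdges u v)).Adj u w := heq.symm ▸ h
    rw [deleteEdges_adj] at h'
    exact h'.2 ⟨_, hp, by simp⟩

theorem exists_lt_of_isTheta [Finite V] {k : ℕ} (hG : IsLCycleGraph {2 * k} G)
    {u v : V} {p q r : G.Walk u v} (h : Walk.IsTheta p q r) :
    ∃ G' < G, ∃ m : ℕ, numCycles G ≤ numCycles G' + m.choose 2 ∧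
      Nat.card G.ConnectedComponent + (2 + m * (k - 1)) ≤ Nat.card G'.ConnectedComponent + 1 := by
  have huv : u ≠ v := by
    rintro rfl
    exact h.ne₁₂ (h.isPath₁.eq_nil_of_closed.trans h.isPath₂.eq_nil_of_closed.symm)
  have hdisj : G.PathsDisjoint u v := by
    intro s t hs ht hst
    obtain ⟨q', r', h'⟩ := h.exists_isTheta hG hs
    exact h'.internallyDisjoint hG ht hst
  have hlen : ∀ s : G.Walk u v, s.IsPath → s.length = k := by
    intro s hs
    obtain ⟨q', r', h'⟩ := h.exists_isTheta hG hs
    exact h'.length_eq hG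
  refine ⟨_, deleteEdges_pathEdges_lt huv ⟨p⟩, _, hdisj.numCycles_le, ?_⟩
  have h1 := ncard_pathVerts_ge hdisj huv hlen ⟨p⟩
  have h2 := hdisj.card_connectedComponent_add_le
  omega

theorem exists_lt_of_isCycle [Finite V] {z : V} {c : G.Walk z z} (hc : c.IsCycle) :
    (∃ G' < G, numCycles G ≤ numCycles G' + 1 ∧
      Nat.card G.ConnectedComponent + c.length ≤ Nat.card G'.ConnectedComponent + 1) ∨
    ∃ (x y : V) (p q r : G.Walk x y), Walk.IsTheta p q r := by
  classical
  refine hc.exists_isTheta_or.imp_left ?_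
  rintro ⟨u, v, p, q, hp, hq, hpq, hd, hp1, hqc, hall⟩
  have huv : u ≠ v := by
    rintro rfl
    exact hpq (hp.eq_nil_of_closed.trans hq.eq_nil_of_closed.symm)
  have hdisj : G.PathsDisjoint u v := by
    intro s t hs ht hst
    rcases hall s hs with rfl | rfl <;> rcases hall t ht with rfl | rfl
    · exact absurd rfl hst
    · exact hd
    · exact hd.symm
    · exact absurd rfl hst
  have h1 := hdisj.card_connectedComponent_add_le
  have h2 := hdisj.numCycles_le
  have hcard : Nat.card (G.Path u v) ≤ 2 := by
    have hinj : Function.Injective fun s : G.Path u v => decide (s.1 = p) := by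
      intro s t hst
      simp only [decide_eq_decide] at hst
      apply Subtype.ext
      rcases hall s.1 s.2 with h | h <;> rcases hall t.1 t.2 with h' | h'
      · rw [h, h']
      · rw [h, hst.1 h]
      · rw [h', hst.2 h']
      · rw [h, h']
    simpa using Nat.card_le_card_of_injective _ hinj
  -- The path `q`, the cycle without one edge, already visits all vertices of the cycle.
  have hverts : c.length ≤ (G.pathVerts u v).ncard := by
    have : q.support.toFinset.card = c.length := by
      rw [List.toFinset_card_of_nodup hq.support_nodup, Walk.length_support, hqc]
    rw [← this, ← Set.ncard_coe_finset]
    refine Set.ncard_le_ncard (fun w hw => ⟨q, hq, ?_⟩) (Set.toFinite _)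
    simpa using hw
  refine ⟨_, deleteEdges_pathEdges_lt huv ⟨p⟩, h2.trans ?_, by omega⟩
  have := Nat.choose_le_choose 2 hcard
  simp at this
  omega

theorem card_connectedComponent_le [Finite V] : Nat.card G.ConnectedComponent ≤ Nat.card V :=
  Nat.card_le_card_of_surjective G.connectedComponentMk fun c => by
    induction c using ConnectedComponent.ind with | _ x
    exact ⟨x, rfl⟩

theorem numCycles_eq_zero (h : ∀ (z : V) (c : G.Walk z z), ¬ c.IsCycle) : numCycles G = 0 := by
  have : cyclesOf G = ∅ := by
    ext H
    simp only [cyclesOf, Set.mem_ofPred_eq, Set.mem_empty_iff_false, iff_false]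
    rintro ⟨z, c, hc, -⟩
    exact h z c hc
  rw [numCycles, this, Set.ncard_empty]

theorem numCycles_mul_add_card_le [Finite V] {L : Set ℕ} {k : ℕ} (hL : ∀ m ∈ L, Odd m)
    (hk : ∀ m ∈ L, 2 * k + 1 ≤ m) (G : SimpleGraph V) (hG : IsLCycleGraph L G) :
    numCycles G * (2 * k) + Nat.card G.ConnectedComponent ≤ Nat.card V := by
  induction G using WellFoundedLT.induction with | _ G ih
  by_cases hc : ∃ (z : V) (c : G.Walk z z), c.IsCycle
  · obtain ⟨z, c, hc⟩ := hc
    have hlen := hk _ (hG z c hc)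
    rcases exists_lt_of_isCycle hc with ⟨G', hlt, h1, h2⟩ | ⟨x, y, p, q, r, h⟩
    · have h3 := ih G' hlt (isLCycleGraph_mono hG hlt.le)
      have h4 := Nat.mul_le_mul_right (2 * k) h1
      rw [add_mul, one_mul] at h4
      omega
    · exact (Walk.not_isTheta_of_forall_odd hL hG h).elim
  · push Not at hc
    rw [numCycles_eq_zero hc, zero_mul, zero_add]
    exact card_connectedComponent_le

/-- Pairs inside two disjoint sets are pairs inside their union. -/
theorem choose_two_add_choose_two_le (m a : ℕ) : a.choose 2 + m.choose 2 ≤ (m + a).choose 2 := by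
  induction a with
  | zero => simp
  | succ a ih =>
    rw [← add_assoc, Nat.choose_succ_succ' a 1, Nat.choose_succ_succ' (m + a) 1,
      Nat.choose_one_right, Nat.choose_one_right]
    simp only [Nat.reduceAdd]
    omega

theorem numCycles_le_choose [Finite V] {k : ℕ} (hk : 2 ≤ k) (G : SimpleGraph V)
    (hG : IsLCycleGraph {2 * k} G) :
    numCycles G ≤ ((Nat.card V - Nat.card G.ConnectedComponent - 1) / (k - 1)).choose 2 := by
  induction G using WellFoundedLT.induction with | _ G ih
  by_cases hc : ∃ (z : V) (c : G.Walk z z), c.IsCycle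
  · obtain ⟨z, c, hc⟩ := hc
    have hlen : c.length = 2 * k := hG z c hc
    have key : ∃ G' < G, ∃ m : ℕ, numCycles G ≤ numCycles G' + m.choose 2 ∧
        Nat.card G.ConnectedComponent + (2 + m * (k - 1)) ≤
          Nat.card G'.ConnectedComponent + 1 := by
      rcases exists_lt_of_isCycle hc with ⟨G', hlt, h1, h2⟩ | ⟨x, y, p, q, r, h⟩
      -- The cycle of length `2k = 2 + 2(k-1)` fits the pattern of `m = 2` paths of length `k`.
      · exact ⟨G', hlt, 2, by simpa using h1, by omega⟩
      · exact exists_lt_of_isTheta hG h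
    obtain ⟨G', hlt, m, h1, h2⟩ := key
    have h3 := ih G' hlt (isLCycleGraph_mono hG hlt.le)
    refine (h1.trans (Nat.add_le_add_right h3 _)).trans
      ((choose_two_add_choose_two_le _ _).trans (Nat.choose_le_choose 2 ?_))
    -- The component count rises by at least `m(k-1) + 1`. The extra unit covers the truncated
    -- subtraction when every component of `G'` is a single vertex.
    rw [Nat.le_div_iff_mul_le (by omega), add_mul]
    have h4 := Nat.div_mul_le_self (Nat.card V - Nat.card G'.ConnectedComponent - 1) (k - 1)
    have h5 : Nat.card G'.ConnectedComponent ≤ Nat.card V := card_connectedComponent_le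
    omega
  · push Not at hc
    rw [numCycles_eq_zero hc]
    exact Nat.zero_le _

theorem one_le_card_connectedComponent [Finite V] [Nonempty V] (G : SimpleGraph V) :
    1 ≤ Nat.card G.ConnectedComponent :=
  Nat.card_pos

theorem maxCycles_le_of_odd {L : Set ℕ} {k : ℕ} (hk : 1 ≤ k) (hL : ∀ m ∈ L, Odd m)
    (hmin : ∀ m ∈ L, 2 * k + 1 ≤ m) (n : ℕ) : maxCycles L n ≤ (n - 1) / (2 * k) := by
  obtain ⟨G, hG, h⟩ := (isGreatest_maxCycles L n).1
  have h1 := numCycles_mul_add_card_le hL hmin G hG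
  rw [h, Nat.card_fin] at h1
  rw [Nat.le_div_iff_mul_le (by omega)]
  rcases Nat.eq_zero_or_pos n with rfl | hn
  · omega
  · have : Nonempty (Fin n) := ⟨⟨0, hn⟩⟩
    have := one_le_card_connectedComponent G
    omega

theorem maxCycles_le_of_even {k : ℕ} (hk : 2 ≤ k) (n : ℕ) :
    maxCycles {2 * k} n ≤ ((n - 2) / (k - 1)).choose 2 := by
  obtain ⟨G, hG, h⟩ := (isGreatest_maxCycles {2 * k} n).1
  have h1 := numCycles_le_choose hk G hG
  rw [h, Nat.card_fin] at h1
  refine h1.trans (Nat.choose_le_choose 2 (Nat.div_le_div_right ?_))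
  rcases Nat.eq_zero_or_pos n with rfl | hn
  · omega
  · have : Nonempty (Fin n) := ⟨⟨0, hn⟩⟩
    have := one_le_card_connectedComponent G
    omega

end SimpleGraph

/-! ### Extremal graphs: bouquets of paths -/

namespace SimpleGraph

theorem isLCycleGraph_of_iso {V W : Type*} {G : SimpleGraph V} {G' : SimpleGraph W} (f : G ≃g G')
    {L : Set ℕ} (hG : IsLCycleGraph L G) : IsLCycleGraph L G' := by
  intro v p hp
  have := hG _ (p.map f.symm.toHom) (hp.map f.symm.injective)
  rwa [Walk.length_map] at this

theorem numCycles_le_of_iso {V W : Type*} [Finite W] {G : SimpleGraph V} {G' : SimpleGraph W}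
    (f : G ≃g G') : numCycles G ≤ numCycles G' := by
  have hinj : Function.Injective (Subgraph.map f.toHom) := by
    refine Function.LeftInverse.injective (g := Subgraph.map f.symm.toHom) fun H => ?_
    rw [← Subgraph.map_comp]
    have : f.symm.toHom.comp f.toHom = Hom.id := by
      ext x
      exact f.symm_apply_apply x
    rw [this, Subgraph.map_id]
  rw [numCycles, ← Set.ncard_image_of_injective _ hinj]
  refine Set.ncard_le_ncard ?_ (Set.toFinite _)
  rintro _ ⟨_, ⟨v, p, hp, rfl⟩, rfl⟩
  exact ⟨_, p.map f.toHom, hp.map f.injective, Walk.toSubgraph_map _ _⟩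

theorem numCycles_le_maxCycles {V : Type*} [Fintype V] {G : SimpleGraph V} {L : Set ℕ} {n : ℕ}
    (hn : Fintype.card V = n) (hG : IsLCycleGraph L G) : numCycles G ≤ maxCycles L n :=
  (numCycles_le_of_iso (G.overFinIso hn)).trans
    ((isGreatest_maxCycles L n).2 ⟨_, isLCycleGraph_of_iso (G.overFinIso hn) hG, rfl⟩)

section Bouquet

variable {X : Type*} {t c r : ℕ} {s e : X}

/-- The `j`-th inner vertex of the `i`-th path of a bouquet. -/
abbrev inner (X : Type*) {t c : ℕ} (r : ℕ) (i : Fin t) (j : Fin c) :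
    X ⊕ (Fin t × Fin c) ⊕ Fin r := Sum.inr (Sum.inl (i, j))

/-- The successor of `inner X r i j` on its path, which ends at `e`. -/
def innerNext (r : ℕ) (e : X) (i : Fin t) (j : Fin c) : X ⊕ (Fin t × Fin c) ⊕ Fin r :=
  if h : j.1 + 1 < c then inner X r i ⟨j.1 + 1, h⟩ else Sum.inl e

/-- The predecessor of `inner X r i j` on its path, which starts at `s`. -/
def innerPrev (r : ℕ) (s : X) (i : Fin t) (j : Fin c) : X ⊕ (Fin t × Fin c) ⊕ Fin r :=
  if j.1 = 0 then Sum.inl s else inner X r i ⟨j.1 - 1, by omega⟩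

/-- The graph that consists of `t` paths with `c` inner vertices each, all of which lead from `s`
to `e`, and of `r` isolated vertices. The vertices `s` and `e` may coincide. -/
def bouquet (t c r : ℕ) (s e : X) : SimpleGraph (X ⊕ (Fin t × Fin c) ⊕ Fin r) :=
  fromRel fun a b => ∃ (i : Fin t) (j : Fin c), a = inner X r i j ∧
    (b = innerNext r e i j ∨ b = innerPrev r s i j)

theorem innerNext_ne (i : Fin t) (j : Fin c) : inner X r i j ≠ innerNext r e i j := by
  unfold innerNext
  split_ifs with h
  · simp [Fin.ext_iff]
  · simp

theorem innerPrev_ne (i : Fin t) (j : Fin c) : inner X r i j ≠ innerPrev r s i j := by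
  unfold innerPrev
  split_ifs with h
  · simp
  · simp only [ne_eq, Sum.inr.injEq, Sum.inl.injEq, Prod.mk.injEq, Fin.ext_iff, true_and]
    omega

theorem innerPrev_of_eq_innerNext {i i' : Fin t} {j j' : Fin c}
    (h : inner X r i' j' = innerNext r e i j) : inner X r i j = innerPrev r s i' j' := by
  unfold innerNext at h
  split_ifs at h with hj
  simp only [Sum.inr.injEq, Sum.inl.injEq, Prod.mk.injEq] at h
  obtain ⟨rfl, rfl⟩ := h
  simp [innerPrev]

theorem innerNext_of_eq_innerPrev {i i' : Fin t} {j j' : Fin c}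
    (h : inner X r i' j' = innerPrev r s i j) : inner X r i j = innerNext r e i' j' := by
  unfold innerPrev at h
  split_ifs at h with hj
  simp only [Sum.inr.injEq, Sum.inl.injEq, Prod.mk.injEq] at h
  obtain ⟨rfl, rfl⟩ := h
  have : j.1 - 1 + 1 = j.1 := by omega
  simp [innerNext, this]

theorem bouquet_adj_inner {i : Fin t} {j : Fin c} {w : X ⊕ (Fin t × Fin c) ⊕ Fin r} :
    (bouquet t c r s e).Adj (inner X r i j) w ↔
      w = innerNext r e i j ∨ w = innerPrev r s i j := by
  rw [bouquet, fromRel_adj]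
  constructor
  · rintro ⟨-, ⟨i', j', h, hw⟩ | ⟨i', j', rfl, hw⟩⟩
    · simp only [Sum.inr.injEq, Sum.inl.injEq, Prod.mk.injEq] at h
      obtain ⟨rfl, rfl⟩ := h
      exact hw
    · exact hw.symm.imp innerNext_of_eq_innerPrev innerPrev_of_eq_innerNext
  · intro h
    refine ⟨?_, Or.inl ⟨i, j, rfl, h⟩⟩
    rcases h with rfl | rfl
    · exact innerNext_ne i j
    · exact innerPrev_ne i j

theorem bouquet_adj_inl {x : X} {w : X ⊕ (Fin t × Fin c) ⊕ Fin r} :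
    (bouquet t c r s e).Adj (Sum.inl x) w ↔ ∃ (i : Fin t) (j : Fin c), w = inner X r i j ∧
      ((x = e ∧ j.1 + 1 = c ∧ innerNext r e i j = Sum.inl e) ∨
        (x = s ∧ j.1 = 0 ∧ innerPrev r s i j = Sum.inl s)) := by
  constructor
  · intro h
    have h' := h
    rw [bouquet, fromRel_adj] at h'
    obtain ⟨-, ⟨i, j, h1, -⟩ | ⟨i, j, rfl, h1⟩⟩ := h'
    · simp at h1
    · refine ⟨i, j, rfl, h1.imp ?_ ?_⟩
      · intro h2
        have h3 := h2
        unfold innerNext at h3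
        split_ifs at h3 with h4
        obtain rfl := Sum.inl.inj h3
        exact ⟨rfl, by omega, h2.symm⟩
      · intro h2
        have h3 := h2
        unfold innerPrev at h3
        split_ifs at h3 with h4
        obtain rfl := Sum.inl.inj h3
        exact ⟨rfl, h4, h2.symm⟩
  · rintro ⟨i, j, rfl, ⟨rfl, -, h⟩ | ⟨rfl, -, h⟩⟩
    · exact (bouquet_adj_inner.2 (Or.inl h.symm)).symm
    · exact (bouquet_adj_inner.2 (Or.inr h.symm)).symm

theorem not_bouquet_adj_inr {x : Fin r} {w : X ⊕ (Fin t × Fin c) ⊕ Fin r} :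
    ¬ (bouquet t c r s e).Adj (Sum.inr (Sum.inr x)) w := by
  intro h
  rw [bouquet, fromRel_adj] at h
  obtain ⟨-, ⟨i, j, h, -⟩ | ⟨i, j, -, h⟩⟩ := h
  · simp at h
  · unfold innerNext innerPrev at h
    split_ifs at h <;> simp at h

/-- Inner vertices have no neighbours but predecessor and successor, so a path that does not step
back is forced on to `e`. The hypothesis excludes an edge, not a vertex, because for `s = e` the
predecessor may be the end of the path. -/
theorem exists_isPath_of_innerPrev_notMem {a b : X ⊕ (Fin t × Fin c) ⊕ Fin r}
    (p : (bouquet t c r s e).Walk a b) (hp : p.IsPath) {i : Fin t} {j : Fin c}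
    (ha : a = inner X r i j) {x : X} (hb : b = Sum.inl x) (h : s(innerPrev r s i j, a) ∉ p.edges) :
    ∃ q : (bouquet t c r s e).Walk (Sum.inl e) b, q.IsPath ∧ p.length = c - j + q.length := by
  induction p generalizing i j with
  | nil => rw [ha] at hb; simp at hb
  | @cons a w b hadj p ih =>
    subst ha
    rw [Walk.cons_isPath_iff] at hp
    rw [Walk.edges_cons, List.mem_cons, not_or] at h
    rcases bouquet_adj_inner.1 hadj with hw | hw
    · have hw' := hw
      unfold innerNext at hw
      split_ifs at hw with hj
      · obtain ⟨q, hq, hlen⟩ := ih hp.1 hw hb (by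
          rw [← innerPrev_of_eq_innerNext (s := s) (hw.symm.trans hw')]
          exact fun hmem => hp.2 (p.fst_mem_support_of_mem_edges hmem))
        refine ⟨q, hq, ?_⟩
        rw [Walk.length_cons, hlen]
        simp only
        omega
      · subst hw
        refine ⟨p, hp.1, ?_⟩
        rw [Walk.length_cons]
        omega
    · exact absurd (by rw [hw]; exact Sym2.eq_swap) h.1

theorem exists_isPath_of_innerNext_notMem {a b : X ⊕ (Fin t × Fin c) ⊕ Fin r}
    (p : (bouquet t c r s e).Walk a b) (hp : p.IsPath) {i : Fin t} {j : Fin c}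
    (ha : a = inner X r i j) {x : X} (hb : b = Sum.inl x) (h : s(innerNext r e i j, a) ∉ p.edges) :
    ∃ q : (bouquet t c r s e).Walk (Sum.inl s) b, q.IsPath ∧ p.length = j + 1 + q.length := by
  induction p generalizing i j with
  | nil => rw [ha] at hb; simp at hb
  | @cons a w b hadj p ih =>
    subst ha
    rw [Walk.cons_isPath_iff] at hp
    rw [Walk.edges_cons, List.mem_cons, not_or] at h
    rcases bouquet_adj_inner.1 hadj with hw | hw
    · exact absurd (by rw [hw]; exact Sym2.eq_swap) h.1
    · have hw' := hw
      unfold innerPrev at hw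
      split_ifs at hw with hj
      · subst hw
        refine ⟨p, hp.1, ?_⟩
        rw [Walk.length_cons]
        omega
      · obtain ⟨q, hq, hlen⟩ := ih hp.1 hw hb (by
          rw [← innerNext_of_eq_innerPrev (e := e) (hw.symm.trans hw')]
          exact fun hmem => hp.2 (p.fst_mem_support_of_mem_edges hmem))
        refine ⟨q, hq, ?_⟩
        rw [Walk.length_cons, hlen]
        simp only
        omega

/-- A cycle uses two distinct neighbours of each of its vertices, hence the predecessor of each
inner vertex; descent along the path reaches `s`. -/
theorem inl_mem_support_of_inner_mem {z : X ⊕ (Fin t × Fin c) ⊕ Fin r}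
    {p : (bouquet t c r s e).Walk z z} (hp : p.IsCycle) (i : Fin t) (m : ℕ) (hm : m < c)
    (h : inner X r i ⟨m, hm⟩ ∈ p.support) : Sum.inl s ∈ p.support := by
  classical
  induction m using Nat.strong_induction_on with | _ m ih
  have hp' := (Walk.isCycle_rotate h).2 hp
  have h1 := bouquet_adj_inner.1 ((p.rotate _ h).adj_snd hp'.not_nil)
  have h2 := bouquet_adj_inner.1 ((p.rotate _ h).adj_penultimate hp'.not_nil).symm
  have h3 := hp'.snd_ne_penultimate
  have h4 : (p.rotate _ h).snd ∈ p.support :=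
    (Walk.mem_support_rotate_iff p _ h).1 (Walk.getVert_mem_support _ _)
  have h5 : (p.rotate _ h).penultimate ∈ p.support :=
    (Walk.mem_support_rotate_iff p _ h).1 (Walk.getVert_mem_support _ _)
  have h6 : innerPrev r s i ⟨m, hm⟩ ∈ p.support := by
    rcases h1 with h1 | h1
    · rcases h2 with h2 | h2
      · exact absurd (h1.trans h2.symm) h3
      · exact h2 ▸ h5
    · exact h1 ▸ h4
  rcases Nat.eq_zero_or_pos m with rfl | hm0
  · exact h6
  · rw [innerPrev, if_neg (by simp only; omega)] at h6
    exact ih (m - 1) (by omega) (by omega) h6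

theorem inl_mem_support_of_isCycle {z : X ⊕ (Fin t × Fin c) ⊕ Fin r}
    {p : (bouquet t c r s e).Walk z z} (hp : p.IsCycle) : Sum.inl s ∈ p.support := by
  have hadj := p.adj_snd hp.not_nil
  rcases z with x | ⟨i, j⟩ | x
  · obtain ⟨i, j, hw, -⟩ := bouquet_adj_inl.1 hadj
    exact inl_mem_support_of_inner_mem hp i j.1 j.2 (hw ▸ Walk.getVert_mem_support _ _)
  · exact inl_mem_support_of_inner_mem hp i j.1 j.2 (Walk.start_mem_support _)
  · exact absurd hadj not_bouquet_adj_inr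

/-- Started at `s`, the cycle is forced through a whole path. This closes it if `s = e`; otherwise
it is at `e` and is forced back to `s` along another whole path. -/
theorem bouquet_cycle_length {z : X ⊕ (Fin t × Fin c) ⊕ Fin r}
    {p : (bouquet t c r s e).Walk z z} (hp : p.IsCycle) :
    (s = e → p.length = c + 1) ∧ (s ≠ e → p.length = 2 * (c + 1)) := by
  classical
  have hs := inl_mem_support_of_isCycle hp
  rw [← Walk.length_rotate p _ hs]
  replace hp := (Walk.isCycle_rotate hs).2 hp
  generalize p.rotate _ hs = q at hp
  cases q with
  | nil => exact absurd hp Walk.not_isCycle_nil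
  | @cons _ w _ hadj q =>
    rw [Walk.cons_isCycle_iff] at hp
    rw [Walk.length_cons]
    obtain ⟨i, j, rfl, ⟨rfl, hj, hn⟩ | ⟨-, hj, hn⟩⟩ := bouquet_adj_inl.1 hadj
    · refine ⟨fun _ => ?_, fun h => absurd rfl h⟩
      obtain ⟨q', hq', hlen⟩ := exists_isPath_of_innerNext_notMem q hp.1 rfl rfl (by rw [hn]; exact hp.2)
      rw [hlen, hq'.eq_nil_of_closed, Walk.length_nil]
      omega
    · obtain ⟨q', hq', hlen⟩ := exists_isPath_of_innerPrev_notMem q hp.1 rfl rfl (by rw [hn]; exact hp.2)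
      constructor
      · rintro rfl
        rw [hlen, hq'.eq_nil_of_closed, Walk.length_nil]
        omega
      · intro hse
        cases q' with
        | nil => exact absurd rfl hse
        | @cons _ w _ hadj' q' =>
          rw [Walk.cons_isPath_iff] at hq'
          obtain ⟨i', j', rfl, ⟨-, hj', hn'⟩ | ⟨h, -⟩⟩ := bouquet_adj_inl.1 hadj'
          · obtain ⟨q'', hq'', hlen'⟩ := exists_isPath_of_innerNext_notMem q' hq'.1 rfl rfl
              (fun hmem => hq'.2 (hn' ▸ q'.fst_mem_support_of_mem_edges hmem))
            rw [hlen, Walk.length_cons, hlen', hq''.eq_nil_of_closed, Walk.length_nil]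
            omega
          · exact absurd h.symm hse

theorem exists_isPath_inner_inl (i : Fin t) (m : ℕ) (j : Fin c) (hj : j.1 + m + 1 = c) :
    ∃ q : (bouquet t c r s e).Walk (inner X r i j) (Sum.inl e), q.IsPath ∧ q.length = m + 1 ∧
      ∀ w ∈ q.support, w = Sum.inl e ∨ ∃ j' : Fin c, j ≤ j' ∧ w = inner X r i j' := by
  induction m generalizing j with
  | zero =>
    have h : (bouquet t c r s e).Adj (inner X r i j) (Sum.inl e) :=
      bouquet_adj_inner.2 (Or.inl (by simp [innerNext]; omega))
    refine ⟨Walk.cons h Walk.nil, by simp, by simp, ?_⟩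
    intro w hw
    simp only [Walk.support_cons, Walk.support_nil, List.mem_cons, List.not_mem_nil,
      or_false] at hw
    exact hw.symm.imp_right fun h => ⟨j, le_rfl, h⟩
  | succ m ih =>
    have hj' : j.1 + 1 < c := by omega
    obtain ⟨q, hq, hlen, hsup⟩ := ih ⟨j.1 + 1, hj'⟩ (by simp only; omega)
    have h : (bouquet t c r s e).Adj (inner X r i j) (inner X r i ⟨j.1 + 1, hj'⟩) :=
      bouquet_adj_inner.2 (Or.inl (by simp [innerNext, hj']))
    refine ⟨Walk.cons h q, ?_, by rw [Walk.length_cons, hlen], ?_⟩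
    · rw [Walk.cons_isPath_iff]
      refine ⟨hq, fun hmem => ?_⟩
      rcases hsup _ hmem with h | ⟨j', hjj, h⟩
      · simp at h
      · simp only [Sum.inr.injEq, Sum.inl.injEq, Prod.mk.injEq, true_and] at h
        subst h
        rw [Fin.le_def] at hjj
        simp at hjj
    · intro w hw
      rw [Walk.support_cons, List.mem_cons] at hw
      rcases hw with rfl | hw
      · exact Or.inr ⟨j, le_rfl, rfl⟩
      · refine (hsup w hw).imp_right ?_
        rintro ⟨j', hjj, rfl⟩
        rw [Fin.le_def] at hjj
        exact ⟨j', by rw [Fin.le_def]; simp only at hjj; omega, rfl⟩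

/-- A lower bound for the number of cycles by the sets of paths that they traverse. -/
theorem choose_le_numCycles_bouquet [Finite X] (hc : 0 < c) (m : ℕ)
    (h : ∀ F : Finset (Fin t), F.card = m → ∃ H ∈ cyclesOf (bouquet t c r s e),
      ∀ i, inner X r i ⟨0, hc⟩ ∈ H.verts ↔ i ∈ F) :
    t.choose m ≤ numCycles (bouquet t c r s e) := by
  classical
  -- The first inner vertex of each path serves as a marker that the path is traversed.
  let g : (bouquet t c r s e).Subgraph → Finset (Fin t) :=
    fun H => {i | inner X r i ⟨0, hc⟩ ∈ H.verts}
  have hsub : ((Finset.powersetCard m (Finset.univ : Finset (Fin t)) :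
      Finset (Finset (Fin t))) : Set (Finset (Fin t))) ⊆ g '' cyclesOf (bouquet t c r s e) := by
    intro F hF
    rw [Finset.mem_coe, Finset.mem_powersetCard] at hF
    obtain ⟨H, hH, hi⟩ := h F hF.2
    refine ⟨H, hH, ?_⟩
    ext i
    simp [g, hi]
  have h1 := (Set.ncard_le_ncard hsub (Set.toFinite _)).trans
    (Set.ncard_image_le (Set.toFinite _))
  rwa [Set.ncard_coe_finset, Finset.card_powersetCard, Finset.card_univ, Fintype.card_fin] at h1

theorem choose_two_le_numCycles_bouquet [Finite X] (hc : 0 < c) (hse : s ≠ e) :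
    t.choose 2 ≤ numCycles (bouquet t c r s e) := by
  refine choose_le_numCycles_bouquet hc 2 fun F hF => ?_
  have hpath : ∀ i : Fin t, ∃ q : (bouquet t c r s e).Walk (Sum.inl s) (Sum.inl e), q.IsPath ∧
      inner X r i ⟨0, hc⟩ ∈ q.support ∧
      ∀ w ∈ q.support, (w = Sum.inl s ∨ w = Sum.inl e) ∨ ∃ j : Fin c, w = inner X r i j := by
    intro i
    obtain ⟨q, hq, -, hsup⟩ := exists_isPath_inner_inl (r := r) (s := s) (e := e) i (c - 1)
      ⟨0, hc⟩ (by simp only; omega)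
    have h : (bouquet t c r s e).Adj (Sum.inl s) (inner X r i ⟨0, hc⟩) :=
      (bouquet_adj_inner.2 (Or.inr (by simp [innerPrev]))).symm
    refine ⟨Walk.cons h q, ?_, by simp, ?_⟩
    · rw [Walk.cons_isPath_iff]
      refine ⟨hq, fun hmem => ?_⟩
      rcases hsup _ hmem with h | ⟨j', -, h⟩
      · exact hse (Sum.inl.inj h)
      · simp at h
    · intro w hw
      rw [Walk.support_cons, List.mem_cons] at hw
      rcases hw with rfl | hw
      · exact Or.inl (Or.inl rfl)
      · rcases hsup w hw with h | ⟨j, -, h⟩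
        · exact Or.inl (Or.inr h)
        · exact Or.inr ⟨j, h⟩
  obtain ⟨a, b, hab, rfl⟩ := Finset.card_eq_two.1 hF
  obtain ⟨p, hp, hap, hps⟩ := hpath a
  obtain ⟨q, hq, hbq, hqs⟩ := hpath b
  have hdisj : p.InternallyDisjoint q := by
    intro w hwp hwq
    rcases hps w hwp with h | ⟨j, rfl⟩
    · exact h
    · rcases hqs _ hwq with h | ⟨j', h⟩
      · exact h
      · simp only [Sum.inr.injEq, Sum.inl.injEq, Prod.mk.injEq] at h
        exact absurd h.1 hab
  have hmem : ∀ {a i : Fin t} {p : (bouquet t c r s e).Walk (Sum.inl s) (Sum.inl e)},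
      (∀ w ∈ p.support, (w = Sum.inl s ∨ w = Sum.inl e) ∨ ∃ j : Fin c, w = inner X r a j) →
      inner X r i ⟨0, hc⟩ ∈ p.support → i = a := by
    intro a i p h hi
    rcases h _ hi with h | ⟨j, h⟩
    · simp at h
    · simp only [Sum.inr.injEq, Sum.inl.injEq, Prod.mk.injEq] at h
      exact h.1
  have hpq : p ≠ q := by
    rintro rfl
    exact hab (hmem hqs hap)
  refine ⟨_, ⟨_, _, hp.isCycle_append_reverse hq hpq hdisj, rfl⟩, fun i => ?_⟩
  rw [Walk.mem_verts_toSubgraph, Walk.mem_support_append_iff, Walk.support_reverse,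
    List.mem_reverse, Finset.mem_insert, Finset.mem_singleton]
  constructor
  · exact Or.imp (hmem hps) (hmem hqs)
  · rintro (rfl | rfl)
    · exact Or.inl hap
    · exact Or.inr hbq

theorem le_numCycles_bouquet [Finite X] (hc : 1 < c) :
    t ≤ numCycles (bouquet t c r s s) := by
  have hc0 : 0 < c := by omega
  refine (Nat.choose_one_right t).ge.trans (choose_le_numCycles_bouquet hc0 1 fun F hF => ?_)
  obtain ⟨a, rfl⟩ := Finset.card_eq_one.1 hF
  obtain ⟨q, hq, hlen, hsup⟩ := exists_isPath_inner_inl (r := r) (s := s) (e := s) a (c - 1)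
    ⟨0, hc0⟩ (by simp only; omega)
  have h : (bouquet t c r s s).Adj (Sum.inl s) (inner X r a ⟨0, hc0⟩) :=
    (bouquet_adj_inner.2 (Or.inr (by simp [innerPrev]))).symm
  have hcyc : (Walk.cons h q).IsCycle := by
    rw [Walk.cons_isCycle_iff]
    refine ⟨hq, fun hmem => ?_⟩
    -- A path that contains the edge between its own ends has length one, but `q` has length `c >
    -- 1`.
    have := hq.length_eq_one_of_mem_edges (by rwa [Sym2.eq_swap])
    omega
  refine ⟨_, ⟨_, _, hcyc, rfl⟩, fun i => ?_⟩
  rw [Walk.mem_verts_toSubgraph, Walk.support_cons, List.mem_cons, Finset.mem_singleton]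
  constructor
  · rintro (h | h)
    · simp at h
    · rcases hsup _ h with h | ⟨j, -, h⟩
      · simp at h
      · simp only [Sum.inr.injEq, Sum.inl.injEq, Prod.mk.injEq] at h
        exact h.1
  · rintro rfl
    exact Or.inr (Walk.start_mem_support _)

end Bouquet

/-! ### Lower bounds -/

theorem le_maxCycles_of_mem {L : Set ℕ} {k : ℕ} (hk : 1 ≤ k) (hL : 2 * k + 1 ∈ L) (n : ℕ) :
    (n - 1) / (2 * k) ≤ maxCycles L n := by
  rcases Nat.eq_zero_or_pos n with rfl | hn
  · simp
  -- One common vertex, `2k` inner vertices per cycle; the remainder of the division is used up by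
  -- isolated vertices.
  · have hG : IsLCycleGraph L (bouquet ((n - 1) / (2 * k)) (2 * k) ((n - 1) % (2 * k)) () ()) := by
      intro v p hp
      rw [(bouquet_cycle_length hp).1 rfl]
      exact hL
    refine (le_numCycles_bouquet (by omega)).trans (numCycles_le_maxCycles ?_ hG)
    simp only [Fintype.card_sum, Fintype.card_unit, Fintype.card_prod, Fintype.card_fin]
    have := Nat.div_add_mod' (n - 1) (2 * k)
    omega

theorem choose_two_le_maxCycles {k : ℕ} (hk : 2 ≤ k) (n : ℕ) :
    ((n - 2) / (k - 1)).choose 2 ≤ maxCycles {2 * k} n := by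
  rcases Nat.lt_or_ge n 2 with hn | hn
  · rw [Nat.sub_eq_zero_of_le hn.le]
    simp
  -- The two elements of `Bool` are the common ends; `k - 1` inner vertices make paths of length
  -- `k`.
  · have hG : IsLCycleGraph {2 * k}
        (bouquet ((n - 2) / (k - 1)) (k - 1) ((n - 2) % (k - 1)) false true) := by
      intro v p hp
      rw [(bouquet_cycle_length hp).2 (by simp), Set.mem_singleton_iff]
      omega
    refine (choose_two_le_numCycles_bouquet (by omega) (by simp)).trans
      (numCycles_le_maxCycles ?_ hG)
    simp only [Fintype.card_sum, Fintype.card_bool, Fintype.card_prod, Fintype.card_fin]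
    have := Nat.div_add_mod' (n - 2) (k - 1)
    omega

end SimpleGraph

theorem corollary2 :
    (∀ (L : Set ℕ) (k : ℕ), 1 ≤ k → (∀ m ∈ L, Odd m) → IsLeast L (2 * k + 1) →
        ∀ n : ℕ, maxCycles L n = (n - 1) / (2 * k)) ∧
    (∀ k : ℕ, 1 ≤ k → ∀ n : ℕ, maxCycles {2 * k + 1} n = (n - 1) / (2 * k)) ∧
    (∀ k : ℕ, 2 ≤ k → ∀ n : ℕ, maxCycles {2 * k} n = ((n - 2) / (k - 1)).choose 2) := by
  have h : ∀ (L : Set ℕ) (k : ℕ), 1 ≤ k → (∀ m ∈ L, Odd m) → IsLeast L (2 * k + 1) →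
      ∀ n : ℕ, maxCycles L n = (n - 1) / (2 * k) := fun L k hk hL hmin n =>
    le_antisymm (SimpleGraph.maxCycles_le_of_odd hk hL (fun m hm => hmin.2 hm) n)
      (SimpleGraph.le_maxCycles_of_mem hk hmin.1 n)
  refine ⟨h, fun k hk n => h _ k hk ?_ isLeast_singleton n, fun k hk n =>
    le_antisymm (SimpleGraph.maxCycles_le_of_even hk n) (SimpleGraph.choose_two_le_maxCycles hk n)⟩
  rintro m rfl
  exact ⟨k, rfl⟩
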